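/- Let $q:G'\to G$ be an epimorphism of (discrete) groups with finite kernel $\Gamma=\operatorname{Ker} q$. For an irreducible representation $\rho:\Gamma\to GL_n(\mathbb{C})$, let $G_\rho\subset G$ be the subgroup of all $\alpha\in G$ such that for some $\widetilde\alpha\in q^{-1}(\alpha)$ the representation $h\mapsto\rho(\widetilde\alpha^{-1}h\widetilde\alpha)$ of $\Gamma$ is equivalent to $\rho$ (i.e. conjugate to $\rho$ by a matrix in $GL_n(\mathbb{C})$). If $G_\rho=G$, choose for each $\alpha\in G$ an element $\widetilde\alpha\in q^{-1}(\alpha)$ and a matrix $M_\alpha\in GL_n(\mathbb{C})$ with $\rho(\widetilde\alpha^{-1}h\widetilde\alpha)=M_\alpha^{-1}\rho(h)M_\alpha$ for all $h\in\Gamma$, and define $\zeta_{\alpha,\beta}\in\mathbb{C}^*$ for $\alpha,\beta\in G$ by $$\zeta_{\alpha,\beta}\,M_\alpha M_\beta=M_{\alpha\beta}\,\rho\bigl(\widetilde{\alpha\beta}^{-1}\,\widetilde\alpha\,\widetilde\beta\bigr).$$ This is a 2-cocycle on $G$, where $G$ acts trivially on $\mathbb{C}^*$. Its class $\zeta_\rho\in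 H^2(G;\mathbb{C}^*)$ depends only on the equivalence class of $\rho$; for $h\in H_2(G)=H_2(G;\mathbb{Z})$ let $\zeta_\rho(h)\in\mathbb{C}^*$ be the evaluation of $\zeta_\rho$ on $h$. For $k=1,2,\ldots$, let $N_k$ be the number of equivalence classes of irreducible $k$-dimensional complex representations $\rho$ of $\Gamma$ with $G_\rho=G$, and let $v_k:H_2(G)\to\mathbb{C}$ be the function $v_k(h)=\sum_\rho\zeta_\rho(h)$, where $\rho$ runs over these equivalence classes. Let $Q$ be the image of the homomorphism $q_*:H_2(G')\to H_2(G)$, and let $[\Gamma,G']$ be the subgroup of $\Gamma$ generated by the commutators of elements of $\Gamma$ with elements of $G'$. Then: (a) For all $k\ge 1$, the function $v_k$ takes only integer values, all of them in $\{-N_k,-N_k+1,\ldots,N_k-1,N_k\}$, and $v_k(h)=0$ for all $h\in H_2(G)\setminus Q$. (b) For all $h\in Q$, we have $v_1(h)=N_1=|\Gamma/[\Gamma,G']|$. (c) For all $k\ge 1$, we have $v_k(0)=N_k$. -/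

import Mathlib

universe u

namespace GroupExt

open CategoryTheory

noncomputable section

/-! ### Integral second homology of a group and evaluation of 2-cocycles -/

/-- The trivial `G`-module `ℤ`; it is lifted to the universe of `G`, as group homology in Mathlib
requires the coefficient ring and the group to live in one universe. -/
abbrev trivialInt (G : Type u) [Group G] : Rep.{u} (ULift.{u} ℤ) G :=
  Rep.trivial (ULift.{u} ℤ) G (ULift.{u} ℤ)

/-- The homology group `H_2(G) = H_2(G; ℤ)`. -/
abbrev H₂ (G : Type u) [Group G] : Type u := groupHomology (trivialInt G) 2

/-- The homomorphism `q_* : H_2(G') → H_2(G)` induced by a group homomorphism `q : G' → G`. -/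
def mapH₂ {G' G : Type u} [Group G'] [Group G] (q : G' →* G) :
    H₂ G' →ₗ[ULift.{u} ℤ] H₂ G :=
  (groupHomology.map (A := trivialInt G') (B := trivialInt G) q
    (𝟙 (trivialInt G')) 2).hom

/-- The 2-cocycle condition for functions `G × G → A`, where `G` acts trivially on the abelian
group `A`. -/
def IsCocycle {G : Type u} [Group G] {A : Type*} [CommGroup A] (f : G × G → A) : Prop :=
  ∀ a b c : G, f (b, c) * f (a, b * c) = f (a * b, c) * f (a, b)

/-- The value of a 2-cochain with values in `A` on an integral 2-chain:
`∑ᵢ nᵢ (aᵢ, bᵢ) ↦ ∏ᵢ f (aᵢ, bᵢ) ^ nᵢ`, written additively. -/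
def evalChain {G : Type u} [Group G] {A : Type*} [CommGroup A] (f : G × G → A) :
    (G × G →₀ ULift.{u} ℤ) →ₗ[ULift.{u} ℤ] Additive A :=
  Finsupp.linearCombination (ULift.{u} ℤ) (fun p => Additive.ofMul (f p))

theorem H2π_surjective (G : Type u) [Group G] :
    Function.Surjective (groupHomology.H2π (trivialInt G)).hom :=
  (ModuleCat.epi_iff_surjective _).1 inferInstance

theorem evalChain_single {G : Type u} [Group G] {A : Type*} [CommGroup A] (f : G × G → A) (p : G × G) (n : ULift.{u} ℤ) :
    evalChain f (Finsupp.single p n) = n.down • Additive.ofMul (f p) :=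
  Finsupp.linearCombination_single _ _ _

theorem evalChain_boundary {G : Type u} [Group G] {A : Type*} [CommGroup A] {f : G × G → A} (hf : IsCocycle f)
    (x : G × G →₀ ULift.{u} ℤ) (hx : x ∈ groupHomology.boundaries₂ (trivialInt G)) :
    evalChain f x = 0 := by
  obtain ⟨y, rfl⟩ := hx
  have : (evalChain f).comp (groupHomology.d₃₂ (trivialInt G)).hom = 0 := by
    refine Finsupp.lhom_ext fun ⟨a, b, c⟩ (n : ULift.{u} ℤ) => ?_
    have h := congrArg Additive.ofMul (hf a b c)
    simp only [ofMul_mul] at h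
    have h2 : (groupHomology.d₃₂ (trivialInt G)).hom (Finsupp.single (a, b, c) n) =
        ((Finsupp.single (b, c) n - Finsupp.single (a * b, c) n + Finsupp.single (a, b * c) n -
          Finsupp.single (a, b) n : G × G →₀ ULift.{u} ℤ)) :=
      groupHomology.d₃₂_single (A := trivialInt G) (a, b, c) n
    refine (congrArg (evalChain f) h2).trans ?_
    rw [map_sub, map_add, map_sub, evalChain_single, evalChain_single, evalChain_single,
      evalChain_single, ← smul_sub, ← smul_add, ← smul_sub, sub_add_eq_add_sub, h]
    have h0 : (Additive.ofMul (f (a * b, c)) + Additive.ofMul (f (a, b)) -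
        Additive.ofMul (f (a * b, c)) - Additive.ofMul (f (a, b))) = 0 := by abel
    rw [h0, smul_zero]
    rfl
  exact LinearMap.congr_fun this y

/-- The evaluation `H_2(G) → A` of (the cohomology class of) a 2-cocycle with values in `A`:
the class of a cycle `∑ᵢ nᵢ (aᵢ, bᵢ)` is sent to `∏ᵢ f (aᵢ, bᵢ) ^ nᵢ`. -/
def evalH₂ {G : Type u} [Group G] {A : Type*} [CommGroup A] (f : G × G → A) (hf : IsCocycle f) :
    H₂ G →ₗ[ULift.{u} ℤ] Additive A :=
  (Submodule.liftQ (LinearMap.ker (groupHomology.H2π (trivialInt G)).hom)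
      ((evalChain f).comp (groupHomology.cycles₂ (trivialInt G)).subtype)
      (fun x hx => evalChain_boundary hf x.1
        ((groupHomology.H2π_eq_zero_iff (A := trivialInt G) x).1 hx))).comp
    ((groupHomology.H2π (trivialInt G)).hom.quotKerEquivOfSurjective
      (H2π_surjective G)).symm.toLinearMap

theorem evalH₂_H2π {G : Type u} [Group G] {A : Type*} [CommGroup A] (f : G × G → A) (hf : IsCocycle f)
    (x : groupHomology.cycles₂ (trivialInt G)) :
    evalH₂ f hf (groupHomology.H2π (trivialInt G) x) = evalChain f x.1 := by
  have : ((groupHomology.H2π (trivialInt G)).hom.quotKerEquivOfSurjective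
      (H2π_surjective G)).symm (groupHomology.H2π (trivialInt G) x) = Submodule.Quotient.mk x := by
    rw [LinearEquiv.symm_apply_eq]; rfl
  simp only [evalH₂, LinearMap.comp_apply, LinearEquiv.coe_coe, this]
  rfl

/-- Cohomologous cocycles have the same values on homology classes. -/
theorem evalH₂_congr {G : Type u} [Group G] {A : Type*} [CommGroup A] {f f' : G × G → A} (hf : IsCocycle f)
    (hf' : IsCocycle f') (l : G → A)
    (h : ∀ a b, f' (a, b) * (l a * l b) = f (a, b) * l (a * b)) (x : H₂ G) :
    evalH₂ f' hf' x = evalH₂ f hf x := by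
  obtain ⟨x, rfl⟩ := H2π_surjective G x
  erw [evalH₂_H2π, evalH₂_H2π]
  have key : evalChain f' = evalChain f -
      (Finsupp.linearCombination (ULift.{u} ℤ) (fun a => Additive.ofMul (l a))).comp
        (groupHomology.d₂₁ (trivialInt G)).hom := by
    refine Finsupp.lhom_ext fun ⟨a, b⟩ (n : ULift.{u} ℤ) => ?_
    have h1 := congrArg Additive.ofMul (h a b)
    simp only [ofMul_mul] at h1
    have h2 : (groupHomology.d₂₁ (trivialInt G)).hom (Finsupp.single (a, b) n) =
        ((Finsupp.single b n - Finsupp.single (a * b) n + Finsupp.single a n :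
          G →₀ ULift.{u} ℤ)) :=
      groupHomology.d₂₁_single (A := trivialInt G) (a, b) n
    have h3 := congrArg (Finsupp.linearCombination (ULift.{u} ℤ)
      (fun a => Additive.ofMul (l a))) h2
    have h4 (a : G) : Finsupp.linearCombination (ULift.{u} ℤ) (fun a => Additive.ofMul (l a))
        (Finsupp.single a n) = n.down • Additive.ofMul (l a) :=
      Finsupp.linearCombination_single _ _ _
    rw [map_add, map_sub, h4, h4, h4, ← smul_sub, ← smul_add] at h3
    rw [evalChain_single, LinearMap.sub_apply, evalChain_single, LinearMap.comp_apply]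
    refine Eq.trans ?_ (congrArg (fun t => n.down • Additive.ofMul (f (a, b)) - t) h3.symm)
    rw [← smul_sub]
    congr 1
    rw [eq_sub_iff_add_eq]
    rw [← sub_eq_zero] at h1 ⊢
    rw [← h1]; abel
  rw [key, LinearMap.sub_apply, LinearMap.comp_apply]
  have hx : (groupHomology.d₂₁ (trivialInt G)).hom x.1 = 0 := x.2
  erw [hx]
  simp

/-! ### Irreducible complex matrix representations -/

/-- The linear representation on `ℂⁿ` given by a homomorphism `Γ → GL_n(ℂ)`. -/
def toRepresentation {Γ : Type u} [Group Γ] {n : ℕ} (ρ : Γ →* GL (Fin n) ℂ) :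
    Representation ℂ Γ (Fin n → ℂ) :=
  (Matrix.toLinAlgEquiv' (R := ℂ) (n := Fin n)).toAlgHom.toMonoidHom.comp
    ((Units.coeHom (Matrix (Fin n) (Fin n) ℂ)).comp ρ)

@[simp] theorem toRepresentation_apply {Γ : Type u} [Group Γ] {n : ℕ} (ρ : Γ →* GL (Fin n) ℂ)
    (h : Γ) (v : Fin n → ℂ) :
    toRepresentation ρ h v = (ρ h : Matrix (Fin n) (Fin n) ℂ).mulVec v :=
  Matrix.toLin'_apply _ _

/-- The irreducible representations `Γ → GL_n(ℂ)` of dimension `n`. -/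
abbrev IrrRep (Γ : Type u) [Group Γ] (n : ℕ) : Type u :=
  {ρ : Γ →* GL (Fin n) ℂ // (toRepresentation ρ).IsIrreducible}

/-- Equivalence of irreducible representations: conjugacy by an invertible matrix. -/
instance irrSetoid (Γ : Type u) [Group Γ] (n : ℕ) : Setoid (IrrRep Γ n) where
  r ρ ρ' := ∃ M : GL (Fin n) ℂ, ∀ h : Γ, ρ'.1 h = M⁻¹ * ρ.1 h * M
  iseqv :=
    { refl := fun ρ => ⟨1, fun h => by simp⟩
      symm := fun {ρ ρ'} ⟨M, hM⟩ => ⟨M⁻¹, fun h => by rw [hM h]; group⟩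
      trans := fun {ρ ρ' ρ''} ⟨M, hM⟩ ⟨M', hM'⟩ =>
        ⟨M * M', fun h => by rw [hM' h, hM h]; group⟩ }

/-- The set of equivalence classes of irreducible `n`-dimensional complex representations
of `Γ`. -/
def Irr (Γ : Type u) [Group Γ] (n : ℕ) : Type u := Quotient (irrSetoid Γ n)

theorem nonempty_of_irr {Γ : Type u} [Group Γ] {n : ℕ} (ρ : IrrRep Γ n) : Nonempty (Fin n) := by
  by_contra hcon
  rw [not_nonempty_iff] at hcon
  have := ρ.2.toNontrivial
  obtain ⟨a, b, hab⟩ := this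
  refine hab ?_
  ext v
  have hv : v = 0 := Subsingleton.elim _ _
  rw [hv]
  exact iff_of_true a.toSubmodule.zero_mem b.toSubmodule.zero_mem

/-- Schur's lemma in matrix form. -/
theorem exists_scalar {Γ : Type u} [Group Γ] {n : ℕ} (ρ : IrrRep Γ n) (X : GL (Fin n) ℂ)
    (hX : ∀ h : Γ, X * ρ.1 h = ρ.1 h * X) :
    ∃ z : ℂˣ, (X : Matrix (Fin n) (Fin n) ℂ) = (z : ℂ) • (1 : Matrix (Fin n) (Fin n) ℂ) := by
  have hirr := ρ.2
  have hn := nonempty_of_irr ρ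
  let T : (toRepresentation ρ.1).IntertwiningMap (toRepresentation ρ.1) :=
    { toLinearMap := Matrix.toLin' (X : Matrix (Fin n) (Fin n) ℂ)
      isIntertwining' := fun h => by
        ext1 i
        ext1
        have := congrArg (fun Y : GL (Fin n) ℂ => (Y : Matrix (Fin n) (Fin n) ℂ)) (hX h)
        simp only [Units.val_mul] at this
        simp only [LinearMap.comp_apply, toRepresentation_apply, Matrix.toLin'_apply,
          Matrix.mulVec_mulVec, this] }
  obtain ⟨c, hc⟩ :=
    (Representation.IsIrreducible.algebraMap_intertwiningMap_bijective_of_isAlgClosed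
      (ρ := toRepresentation ρ.1)).2 T
  have hXc : (X : Matrix (Fin n) (Fin n) ℂ) = c • (1 : Matrix (Fin n) (Fin n) ℂ) := by
    apply Matrix.toLin'.injective
    ext1 i
    ext1
    have := congrArg (fun S : (toRepresentation ρ.1).IntertwiningMap (toRepresentation ρ.1) =>
      S.toLinearMap (Pi.single i 1)) hc
    simp only [LinearMap.comp_apply, LinearMap.coe_single]
    refine this.symm.trans ?_
    rw [map_smul, Matrix.toLin'_one]
    rfl
  have hc0 : c ≠ 0 := by
    rintro rfl
    rw [zero_smul] at hXc
    exact X.ne_zero hXc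
  exact ⟨Units.mk0 c hc0, hXc⟩

/-- A finite group has only finitely many irreducible representations up to equivalence. -/
instance finite_irr (Γ : Type u) [Group Γ] [Finite Γ] (n : ℕ) : Finite (Irr Γ n) := by
  classical
  have := Fintype.ofFinite Γ
  have : Invertible (Nat.card Γ : ℂ) := invertibleOfNonzero (by simp)
  let χ : Irr Γ n → Γ → ℂ := fun c => (toRepresentation c.out.1).character
  have hχ : ∀ c d : Irr Γ n, (Nat.card Γ : ℂ)⁻¹ * ∑ g : Γ, χ c g * χ d g⁻¹ =
      if c = d then 1 else 0 := by
    intro c d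
    have hc := c.out.2
    have hd := d.out.2
    refine (Representation.char_orthonormal (toRepresentation c.out.1)
      (toRepresentation d.out.1)).trans ?_
    congr 1
    refine propext ⟨?_, ?_⟩
    · rintro ⟨e⟩
      rw [← Quotient.out_eq c, ← Quotient.out_eq d]
      refine Quotient.sound ?_
      let E : (Fin n → ℂ) ≃ₗ[ℂ] (Fin n → ℂ) := e.toLinearEquiv
      have h1 : LinearMap.toMatrix' E.toLinearMap * LinearMap.toMatrix' E.symm.toLinearMap = 1 := by
        rw [← LinearMap.toMatrix'_comp]; simp
      have h2 : LinearMap.toMatrix' E.symm.toLinearMap * LinearMap.toMatrix' E.toLinearMap = 1 := by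
        rw [← LinearMap.toMatrix'_comp]; simp
      refine ⟨⟨_, _, h1, h2⟩, fun h => ?_⟩
      rw [mul_assoc, eq_inv_mul_iff_mul_eq]
      ext1
      apply Matrix.toLin'.injective
      simp only [Units.val_mul, Matrix.toLin'_mul, Matrix.toLin'_toMatrix']
      exact e.toIntertwiningMap.isIntertwining' h
    · rintro rfl
      exact ⟨Representation.Equiv.refl _⟩
  have hli : LinearIndependent ℂ χ := by
    rw [linearIndependent_iff']
    intro s a ha d hd
    have h : (Nat.card Γ : ℂ)⁻¹ * ∑ g : Γ, (∑ c ∈ s, a c • χ c) g * χ d g⁻¹ = a d := by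
      have e : ∀ c ∈ s, a c * ((Nat.card Γ : ℂ)⁻¹ * ∑ g : Γ, χ c g * χ d g⁻¹) =
          if c = d then a c else 0 := fun c _ => by rw [hχ]; simp
      calc _ = ∑ c ∈ s, a c * ((Nat.card Γ : ℂ)⁻¹ * ∑ g : Γ, χ c g * χ d g⁻¹) := by
            simp only [Finset.sum_apply, Pi.smul_apply, smul_eq_mul, Finset.sum_mul,
              Finset.mul_sum]
            rw [Finset.sum_comm]
            refine Finset.sum_congr rfl fun c _ => Finset.sum_congr rfl fun g _ => by ring
        _ = a d := by rw [Finset.sum_congr rfl e]; simp [hd]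
    rw [← h, ha]; simp
  exact hli.finite

/-! ### The action on irreducible representations of the kernel and its stabilizers -/

section Kernel

variable {G G' : Type u} [Group G] [Group G'] (q : G' →* G) {n : ℕ}

/-- Conjugation `h ↦ x⁻¹ h x` of `Γ = Ker q` by an element `x` of `G'`. -/
abbrev conjInv (x : G') (h : q.ker) : q.ker := MulAut.conjNormal x⁻¹ h

theorem coe_conjInv (x : G') (h : q.ker) : (conjInv q x h : G') = x⁻¹ * h * x := by
  simp [conjInv]

/-- The matrix `M` conjugates `ρ` into the representation `h ↦ ρ(x⁻¹ h x)`. -/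
def Intertwines (ρ : q.ker →* GL (Fin n) ℂ) (x : G') (M : GL (Fin n) ℂ) : Prop :=
  ∀ h : q.ker, ρ (conjInv q x h) = M⁻¹ * ρ h * M

variable {q} in
theorem Intertwines.mul {ρ : q.ker →* GL (Fin n) ℂ} {x y : G'} {M N : GL (Fin n) ℂ}
    (hx : Intertwines q ρ x M) (hy : Intertwines q ρ y N) : Intertwines q ρ (x * y) (M * N) := by
  intro h
  have e : conjInv q (x * y) h = conjInv q y (conjInv q x h) := by
    ext; simp only [coe_conjInv]; group
  rw [e, hy, hx]; group

variable {q} in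
theorem Intertwines.inv {ρ : q.ker →* GL (Fin n) ℂ} {x : G'} {M : GL (Fin n) ℂ}
    (hx : Intertwines q ρ x M) : Intertwines q ρ x⁻¹ M⁻¹ := by
  intro h
  have e : h = conjInv q x (conjInv q x⁻¹ h) := by
    ext; simp only [coe_conjInv]; group
  conv_rhs => rw [e, hx]
  group

theorem intertwines_ker (ρ : q.ker →* GL (Fin n) ℂ) (γ : q.ker) : Intertwines q ρ γ (ρ γ) := by
  intro h
  have e : conjInv q γ h = γ⁻¹ * h * γ := by
    ext; simp only [coe_conjInv]; simp
  rw [e]; simp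

variable {q} in
theorem Intertwines.conj {ρ ρ' : q.ker →* GL (Fin n) ℂ} {P : GL (Fin n) ℂ}
    (hP : ∀ h, ρ' h = P⁻¹ * ρ h * P) {x : G'} {M : GL (Fin n) ℂ} (hx : Intertwines q ρ x M) :
    Intertwines q ρ' x (P⁻¹ * M * P) := by
  intro h
  rw [hP, hP, hx]; group

/-- The stabilizer `G_ρ ⊆ G` of the equivalence class of `ρ`: all `α ∈ G` such that for some
`x ∈ q⁻¹(α)` the representation `h ↦ ρ(x⁻¹ h x)` is equivalent to `ρ`. -/
def stabilizer (ρ : q.ker →* GL (Fin n) ℂ) : Subgroup G where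
  carrier := {α | ∃ x : G', q x = α ∧ ∃ M : GL (Fin n) ℂ, Intertwines q ρ x M}
  mul_mem' := by
    rintro _ _ ⟨x, rfl, M, hM⟩ ⟨y, rfl, N, hN⟩
    exact ⟨x * y, map_mul q x y, M * N, hM.mul hN⟩
  one_mem' := ⟨1, map_one q, 1, fun h => by simp [conjInv]⟩
  inv_mem' := by
    rintro _ ⟨x, rfl, M, hM⟩
    exact ⟨x⁻¹, map_inv q x, M⁻¹, hM.inv⟩

/-- The stabilizer `G_ρ` depends only on the equivalence class of `ρ`. -/
def classStabilizer (c : Irr q.ker n) : Subgroup G :=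
  Quotient.lift (fun ρ : IrrRep q.ker n => stabilizer q ρ.1) (by
    rintro ρ ρ' ⟨P, hP⟩
    have hP' : ∀ h, ρ.1 h = (P⁻¹)⁻¹ * ρ'.1 h * P⁻¹ := fun h => by rw [hP]; group
    ext α
    constructor
    · rintro ⟨x, hx, M, hM⟩
      exact ⟨x, hx, _, hM.conj hP⟩
    · rintro ⟨x, hx, M, hM⟩
      exact ⟨x, hx, _, hM.conj hP'⟩) c

/-! ### The cohomology class of an invariant irreducible representation -/

/-- The choices made in the construction of the 2-cocycle of a representation `ρ` of `Γ = Ker q`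
with `G_ρ = G`: for every `α ∈ G` an element `lift α ∈ q⁻¹(α)` and a matrix `M α` with
`ρ((lift α)⁻¹ h (lift α)) = (M α)⁻¹ ρ(h) (M α)` for all `h ∈ Γ`. -/
structure Choices (ρ : IrrRep q.ker n) where
  lift : G → G'
  map_lift : ∀ α, q (lift α) = α
  M : G → GL (Fin n) ℂ
  intertwines : ∀ α, Intertwines q ρ.1 (lift α) (M α)

theorem nonempty_choices (ρ : IrrRep q.ker n) (hρ : stabilizer q ρ.1 = ⊤) :
    Nonempty (Choices q ρ) := by
  have h : ∀ α : G, ∃ x : G', q x = α ∧ ∃ M : GL (Fin n) ℂ, Intertwines q ρ.1 x M :=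
    fun α => (hρ ▸ Subgroup.mem_top α : α ∈ stabilizer q ρ.1)
  choose x hx M hM using h
  exact ⟨⟨x, hx, M, hM⟩⟩

/-- Scalar matrices as elements of `GL_n(ℂ)`. -/
def scalarGL (n : ℕ) (z : ℂˣ) : GL (Fin n) ℂ :=
  Units.map (algebraMap ℂ (Matrix (Fin n) (Fin n) ℂ)).toMonoidHom z

theorem scalarGL_comm (z : ℂˣ) (X : GL (Fin n) ℂ) : scalarGL n z * X = X * scalarGL n z := by
  ext1
  exact Algebra.commutes _ _

theorem scalarGL_mul (z w : ℂˣ) : scalarGL n (z * w) = scalarGL n z * scalarGL n w :=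
  map_mul _ z w

theorem coe_scalarGL_mul (z : ℂˣ) (X : GL (Fin n) ℂ) :
    ((scalarGL n z * X : GL (Fin n) ℂ) : Matrix (Fin n) (Fin n) ℂ) =
      (z : ℂ) • (X : Matrix (Fin n) (Fin n) ℂ) := by
  rw [Algebra.smul_def]; rfl

theorem scalarGL_injective (ρ : IrrRep q.ker n) : Function.Injective (scalarGL n) := by
  have := nonempty_of_irr ρ
  intro z w h
  have h' := congrArg (fun Y : GL (Fin n) ℂ => (Y : Matrix (Fin n) (Fin n) ℂ)) h
  exact Units.ext ((algebraMap ℂ (Matrix (Fin n) (Fin n) ℂ)).injective h')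

variable {q} in
/-- Two matrices intertwining the same pair of representations differ by a scalar. -/
theorem Intertwines.exists_scalar {ρ : IrrRep q.ker n} {x : G'} {M N : GL (Fin n) ℂ}
    (hM : Intertwines q ρ.1 x M) (hN : Intertwines q ρ.1 x N) :
    ∃ z : ℂˣ, scalarGL n z * M = N := by
  obtain ⟨z, hz⟩ := GroupExt.exists_scalar ρ (N * M⁻¹) (fun h => by
    have h1 := (hM h).symm.trans (hN h)
    calc N * M⁻¹ * ρ.1 h = N * (M⁻¹ * ρ.1 h * M) * M⁻¹ := by group
      _ = N * (N⁻¹ * ρ.1 h * N) * M⁻¹ := by rw [h1]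
      _ = ρ.1 h * (N * M⁻¹) := by group)
  refine ⟨z, ?_⟩
  have : scalarGL n z = N * M⁻¹ := by
    ext1
    rw [hz]
    exact Algebra.algebraMap_eq_smul_one _
  rw [this]; group

namespace Choices

variable {q} {ρ : IrrRep q.ker n} (D : Choices q ρ)

/-- The element `(lift αβ)⁻¹ (lift α) (lift β)` of `Γ`. -/
def defect (α β : G) : q.ker :=
  ⟨(D.lift (α * β))⁻¹ * D.lift α * D.lift β, by simp [MonoidHom.mem_ker, D.map_lift]⟩

theorem exists_zeta (α β : G) :
    ∃! z : ℂˣ, (z : ℂ) • ((D.M α * D.M β : GL (Fin n) ℂ) : Matrix (Fin n) (Fin n) ℂ) =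
      (D.M (α * β) * ρ.1 (D.defect α β) : GL (Fin n) ℂ) := by
  have h1 := (D.intertwines α).mul (D.intertwines β)
  have h2 := (D.intertwines (α * β)).mul (intertwines_ker q ρ.1 (D.defect α β))
  have e : D.lift (α * β) * (D.defect α β : G') = D.lift α * D.lift β := by
    simp [defect, mul_assoc]
  rw [e] at h2
  obtain ⟨z, hz⟩ := h1.exists_scalar h2
  refine ⟨z, ?_, fun w hw => ?_⟩
  · simp only [← coe_scalarGL_mul, hz]
  · simp only [← coe_scalarGL_mul] at hw
    exact scalarGL_injective q ρ (mul_right_cancel ((Units.ext hw).trans hz.symm))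

/-- The cocycle `ζ_{α,β} ∈ ℂ^*`, defined by
`ζ_{α,β} M_α M_β = M_{αβ} ρ((lift αβ)⁻¹ (lift α) (lift β))`. -/
def zeta (p : G × G) : ℂˣ := (D.exists_zeta p.1 p.2).choose

theorem zeta_spec (α β : G) :
    (D.zeta (α, β) : ℂ) • ((D.M α * D.M β : GL (Fin n) ℂ) : Matrix (Fin n) (Fin n) ℂ) =
      (D.M (α * β) * ρ.1 (D.defect α β) : GL (Fin n) ℂ) :=
  (D.exists_zeta α β).choose_spec.1

theorem zeta_spec' (α β : G) :
    scalarGL n (D.zeta (α, β)) * (D.M α * D.M β) = D.M (α * β) * ρ.1 (D.defect α β) :=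
  Units.ext ((coe_scalarGL_mul _ _).trans (D.zeta_spec α β))

/-- The element `(lift (q x))⁻¹ x` of `Γ`. -/
def resid (x : G') : q.ker :=
  ⟨(D.lift (q x))⁻¹ * x, by simp [MonoidHom.mem_ker, D.map_lift]⟩

theorem lift_mul_resid (x : G') : D.lift (q x) * (D.resid x : G') = x := by simp [resid]

/-- The extension of `ρ` to a projective representation of `G'`. -/
def proj (x : G') : GL (Fin n) ℂ := D.M (q x) * ρ.1 (D.resid x)

theorem proj_intertwines (x : G') : Intertwines q ρ.1 x (D.proj x) := by
  have := (D.intertwines (q x)).mul (intertwines_ker q ρ.1 (D.resid x))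
  rwa [lift_mul_resid] at this

theorem proj_lift (α : G) : D.proj (D.lift α) = D.M α := by
  have e : D.resid (D.lift α) = 1 := by ext; simp [resid, D.map_lift]
  rw [proj, e, map_one, mul_one, D.map_lift]

theorem proj_mul_ker (x : G') (γ : q.ker) : D.proj (x * γ) = D.proj x * ρ.1 γ := by
  have hq : q (x * γ) = q x := by rw [map_mul, (MonoidHom.mem_ker).1 γ.2, mul_one]
  have e : D.resid (x * γ) = D.resid x * γ := by ext; simp only [resid, hq, Subgroup.coe_mul]; group
  rw [proj, proj, e, hq, map_mul, mul_assoc]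

theorem exists_lift_mul (x : G') : ∃ γ : q.ker, x = D.lift (q x) * γ :=
  ⟨D.resid x, (D.lift_mul_resid x).symm⟩

theorem proj_mul (x y : G') :
    scalarGL n (D.zeta (q x, q y)) * (D.proj x * D.proj y) = D.proj (x * y) := by
  obtain ⟨γ, hγ⟩ := D.exists_lift_mul x
  obtain ⟨δ, hδ⟩ := D.exists_lift_mul y
  set α := q x
  set β := q y
  have hxy : x * y = D.lift (α * β) *
      ((D.defect α β * conjInv q (D.lift β) γ * δ : q.ker) : G') := by
    rw [hγ, hδ]
    simp only [Subgroup.coe_mul, coe_conjInv, defect]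
    group
  have hc : ρ.1 γ * D.M β = D.M β * ρ.1 (conjInv q (D.lift β) γ) := by
    rw [D.intertwines β γ]; group
  rw [hxy, proj_mul_ker, proj_lift, hγ, hδ, proj_mul_ker, proj_mul_ker, proj_lift, proj_lift,
    map_mul, map_mul]
  calc _ = scalarGL n (D.zeta (α, β)) * (D.M α * (ρ.1 γ * D.M β) * ρ.1 δ) := by group
    _ = scalarGL n (D.zeta (α, β)) * (D.M α * D.M β) *
        (ρ.1 (conjInv q (D.lift β) γ) * ρ.1 δ) := by rw [hc]; group
    _ = _ := by rw [D.zeta_spec']; simp only [mul_assoc]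

theorem zeta_isCocycle : IsCocycle D.zeta := by
  intro a b c
  have hab := D.proj_mul (D.lift a) (D.lift b)
  have hbc := D.proj_mul (D.lift b) (D.lift c)
  have h1 := D.proj_mul (D.lift a * D.lift b) (D.lift c)
  have h2 := D.proj_mul (D.lift a) (D.lift b * D.lift c)
  simp only [map_mul, D.map_lift] at hab hbc h1 h2
  rw [← hab] at h1
  rw [← hbc, ← mul_assoc (D.lift a), ← h1] at h2
  apply scalarGL_injective q ρ
  rw [scalarGL_mul, scalarGL_mul]
  have hc := scalarGL_comm (n := n) (D.zeta (b, c)) (D.proj (D.lift a))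
  refine mul_right_cancel (b := D.proj (D.lift a) * D.proj (D.lift b) * D.proj (D.lift c)) ?_
  calc _ = scalarGL n (D.zeta (a, b * c)) * (scalarGL n (D.zeta (b, c)) * D.proj (D.lift a)) *
        (D.proj (D.lift b) * D.proj (D.lift c)) := by
          rw [← scalarGL_mul, mul_comm (D.zeta (b, c)), scalarGL_mul]; group
    _ = scalarGL n (D.zeta (a, b * c)) * (D.proj (D.lift a) *
        (scalarGL n (D.zeta (b, c)) * (D.proj (D.lift b) * D.proj (D.lift c)))) := by
          rw [hc]; group
    _ = _ := by rw [h2]; group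

/-- The value `ζ_ρ(h) ∈ ℂ^*` of the cohomology class of the cocycle on `h ∈ H_2(G)`. -/
def eval (h : H₂ G) : ℂˣ := (evalH₂ D.zeta D.zeta_isCocycle h).toMul

/-- The class `ζ_ρ` does not depend on the choices and depends only on the equivalence class
of `ρ`. -/
theorem eval_congr {ρ' : IrrRep q.ker n} (h : ρ ≈ ρ') (D' : Choices q ρ') (x : H₂ G) :
    D'.eval x = D.eval x := by
  obtain ⟨P, hP⟩ := h
  have hl : ∀ α, ∃ z : ℂˣ, scalarGL n z * (P⁻¹ * D.proj (D.lift α) * P) = D'.proj (D.lift α) :=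
    fun α => ((D.proj_intertwines (D.lift α)).conj hP).exists_scalar (D'.proj_intertwines _)
  choose l hl using hl
  have key : ∀ x, scalarGL n (l (q x)) * (P⁻¹ * D.proj x * P) = D'.proj x := by
    intro x
    have h1 : D'.proj x = D'.proj (D.lift (q x)) * ρ'.1 (D.resid x) := by
      rw [← proj_mul_ker, lift_mul_resid]
    have h2 : D.proj x = D.proj (D.lift (q x)) * ρ.1 (D.resid x) := by
      rw [← proj_mul_ker, lift_mul_resid]
    rw [h1, h2, ← hl, hP]
    group
  refine congrArg Additive.toMul (evalH₂_congr D.zeta_isCocycle D'.zeta_isCocycle l ?_ x)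
  intro a b
  have h1 := D.proj_mul (D.lift a) (D.lift b)
  have h2 := D'.proj_mul (D.lift a) (D.lift b)
  rw [← key, ← key, ← key, ← h1, map_mul, D.map_lift, D.map_lift] at h2
  apply scalarGL_injective q ρ
  simp only [scalarGL_mul]
  have hb := scalarGL_comm (n := n) (l b) (P⁻¹ * D.proj (D.lift a) * P)
  have hz := scalarGL_comm (n := n) (D.zeta (a, b)) P⁻¹
  refine mul_right_cancel (b := P⁻¹ * (D.proj (D.lift a) * D.proj (D.lift b)) * P) ?_
  calc _ = scalarGL n (D'.zeta (a, b)) * scalarGL n (l a) *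
        (scalarGL n (l b) * (P⁻¹ * D.proj (D.lift a) * P)) *
          (P⁻¹ * D.proj (D.lift b) * P) := by group
    _ = scalarGL n (D'.zeta (a, b)) * (scalarGL n (l a) * (P⁻¹ * D.proj (D.lift a) * P) *
          (scalarGL n (l b) * (P⁻¹ * D.proj (D.lift b) * P))) := by rw [hb]; group
    _ = scalarGL n (l (a * b)) * (P⁻¹ * scalarGL n (D.zeta (a, b))) *
          (D.proj (D.lift a) * D.proj (D.lift b)) * P := by rw [h2]; group
    _ = _ := by
          rw [← hz, ← mul_assoc (scalarGL n (l (a * b))), ← scalarGL_mul,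
            mul_comm (l (a * b)), scalarGL_mul]
          group

end Choices

/-- The value `ζ_ρ(h) ∈ ℂ^*` for `h ∈ H_2(G)` and an equivalence class `c` of irreducible
representations `ρ` with `G_ρ = G`. -/
def zetaValue (c : Irr q.ker n) (hc : classStabilizer q c = ⊤) (h : H₂ G) : ℂˣ :=
  (Classical.choice (nonempty_choices q c.out (by
    rw [← hc]
    conv_rhs => rw [← Quotient.out_eq c]
    rfl))).eval h

theorem zetaValue_mk (ρ : IrrRep q.ker n) (D : Choices q ρ)
    (hc : classStabilizer q (Quotient.mk _ ρ : Irr q.ker n) = ⊤) (h : H₂ G) :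
    zetaValue q (Quotient.mk _ ρ : Irr q.ker n) hc h = D.eval h :=
  D.eval_congr (Setoid.symm (Quotient.mk_out ρ)) _ h

/-- The set of equivalence classes of irreducible `k`-dimensional representations `ρ` of
`Γ = Ker q` such that `G_ρ = G`. -/
abbrev InvIrr (k : ℕ) : Type u := {c : Irr q.ker k // classStabilizer q c = ⊤}

/-- The number `N_k`. -/
def invCount (k : ℕ) : ℕ := Nat.card (InvIrr q k)

/-- The function `v_k : H_2(G) → ℂ`, the sum of the values `ζ_ρ(h)` over all classes of
irreducible `k`-dimensional `ρ` with `G_ρ = G`. The sum is finite when `Γ` is finite. -/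
def v (k : ℕ) (h : H₂ G) : ℂ := ∑ᶠ c : InvIrr q k, (zetaValue q c.1 c.2 h : ℂ)

end Kernel

end

end GroupExt

namespace GroupExt

open CategoryTheory

noncomputable section

/-! ### Automorphisms of `ℂ` -/

/-! The function `v k` is controlled by two kinds of symmetry of the finite set of invariant classes
`InvIrr q k`. Both are instances of the twist `h ↦ χ(h) σ(ρ(h))`, where `σ` is a field automorphism
of `ℂ` and `χ` a character of `Γ` invariant under conjugation by `G'`.

Integrality: twisting by `σ` alone permutes the classes and replaces `ζ_ρ(h)` by `σ(ζ_ρ(h))`, so `v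
k h` is fixed by every automorphism of `ℂ` (`map_v`). Determinants show that each `ζ_ρ(h)` is a root
of unity (`Choices.eval_pow`). Hence `v k h` is an algebraic integer fixed by all of `Aut ℂ`, that
is, an integer, and the triangle inequality bounds it by `N_k`.

Vanishing off `Q`: since `ℂ^*` is divisible, a class `h ∉ Q` is detected by a cocycle `f` on `G`
whose pull-back to `G'` is the coboundary of some `g`; up to a constant, `g` restricts on `Γ` to an
invariant character `χ`. Twisting by `χ` permutes the classes and multiplies every `ζ_ρ(h)` by the
same `f(h)⁻¹ ≠ 1`, so the sum is zero (`v_eq_zero`).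

In dimension one the projective extension of `ρ` to `G'` is scalar, so `ζ_ρ` pulls back to a
coboundary and equals `1` on `Q`. Invariant one-dimensional classes are the characters of the finite
abelian group `Γ/[Γ, G']`, which are as many as its elements. At `h = 0` every summand is `1`. -/

/-- Automorphisms of a subfield of an algebraically closed field extend. -/
theorem exists_ringEquiv_extending {E K : Type*} [Field E] [Field K] [Algebra E K] [IsAlgClosed K]
    (τ : E ≃+* E) : ∃ σ : K ≃+* K, ∀ x, σ (algebraMap E K x) = algebraMap E K (τ x) := by
  obtain ⟨s, hs⟩ := exists_isTranscendenceBasis E K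
  -- `τ` acts on the coefficients of the polynomial subring generated by the transcendence basis
  -- `s`. As `K` is an algebraic closure of that subring, the action extends to `K`.
  let a := hs.1.aevalEquiv
  let b := (a.symm.toRingEquiv.trans (MvPolynomial.mapEquiv s τ)).trans a.toRingEquiv
  have := IsAlgClosed.isAlgClosure_of_transcendence_basis _ hs
  refine ⟨IsAlgClosure.equivOfEquiv K K b, fun x => ?_⟩
  have h := IsAlgClosure.equivOfEquiv_algebraMap K K b (algebraMap E _ x)
  rw [← IsScalarTower.algebraMap_apply] at h
  rw [h]
  have hb : b (algebraMap E _ x) = algebraMap E _ (τ x) := by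
    change a (MvPolynomial.map (τ : E →+* E) (a.symm (algebraMap E _ x))) = _
    rw [AlgEquiv.commutes, MvPolynomial.algebraMap_eq, MvPolynomial.map_C,
      ← MvPolynomial.algebraMap_eq, AlgEquiv.commutes]
    rfl
  rw [hb, ← IsScalarTower.algebraMap_apply]

/-- An algebraic integer fixed by all automorphisms of `ℂ` is an integer. -/
theorem exists_int_of_forall_ringEquiv {x : ℂ} (hx : IsIntegral ℤ x)
    (h : ∀ σ : ℂ ≃+* ℂ, σ x = x) : ∃ m : ℤ, x = m := by
  have hxQ : IsIntegral ℚ x := hx.tower_top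
  let E := algebraicClosure ℚ ℂ
  have : IsAlgClosure ℚ E := algebraicClosure.isAlgClosure ℚ ℂ
  have : Normal ℚ E := IsAlgClosure.normal ℚ E
  have : IsGalois ℚ E := ⟨⟩
  let y : E := ⟨x, hxQ⟩
  -- Each automorphism of `ℚ̄` extends to `ℂ`, so `x` is fixed by the whole Galois group of `ℚ̄/ℚ`
  -- and is rational; `ℤ` is integrally closed.
  have hy : ∀ τ : E ≃ₐ[ℚ] E, τ y = y := by
    intro τ
    obtain ⟨σ, hσ⟩ := exists_ringEquiv_extending (K := ℂ) τ.toRingEquiv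
    exact Subtype.ext ((hσ y).symm.trans (h σ))
  obtain ⟨r, hr⟩ := (InfiniteGalois.mem_bot_iff_fixed y).2 hy
  have hr' : algebraMap ℚ ℂ r = x := congrArg (algebraMap E ℂ) hr
  rw [← hr'] at hx
  obtain ⟨m, hm⟩ := IsIntegrallyClosed.isIntegral_iff.1
    ((isIntegral_algebraMap_iff (algebraMap ℚ ℂ).injective).1 hx)
  exact ⟨m, by rw [← hr', ← hm]; simp⟩

/-! ### Homomorphisms to `ℂ^*` -/

instance : DivisibleBy (Additive ℂˣ) ℤ :=
  have : DivisibleBy (Additive ℂˣ) ℕ := divisibleByOfSMulRightSurj _ _ fun {n} hn z => by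
    obtain ⟨w, hw⟩ := IsAlgClosed.exists_pow_nat_eq (z.toMul : ℂ) (Nat.pos_of_ne_zero hn)
    have hw0 : w ≠ 0 := by
      rintro rfl
      rw [zero_pow hn] at hw
      exact z.toMul.ne_zero hw.symm
    exact ⟨Additive.ofMul (Units.mk0 w hw0), congrArg Additive.ofMul (Units.ext hw)⟩
  AddGroup.divisibleByIntOfDivisibleByNat _

/-- `F` factors through `M ⧸ ker d`, which embeds in `N`; the divisible group `ℂ^*` is injective, so
the factored map extends to `N`. -/
theorem exists_addMonoidHom_comp_eq {M N : Type*} [AddCommGroup M] [AddCommGroup N]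
    (d : M →+ N) (F : M →+ Additive ℂˣ) (h : ∀ x, d x = 0 → F x = 0) :
    ∃ L : N →+ Additive ℂˣ, ∀ x, L (d x) = F x := by
  obtain ⟨L, hL⟩ := (Module.Baer.of_divisible (A := Additive ℂˣ)).extension_property_addMonoidHom
    (QuotientAddGroup.kerLift d) (QuotientAddGroup.kerLift_injective d)
    (QuotientAddGroup.lift d.ker F fun x hx => h x hx)
  exact ⟨L, fun x => DFunLike.congr_fun hL (x : M ⧸ d.ker)⟩

/-- Characters with values in `ℚ/ℤ` separate points of `M ⧸ N`, and `r ↦ exp(2πir)` embeds `ℚ/ℤ` in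
`ℂ^*`. -/
theorem exists_addMonoidHom_ne_zero {M : Type*} [AddCommGroup M] (N : AddSubgroup M) {x : M}
    (hx : x ∉ N) : ∃ φ : M →+ Additive ℂˣ, (∀ y ∈ N, φ y = 0) ∧ φ x ≠ 0 := by
  have hx' : (x : M ⧸ N) ≠ 0 := fun h => hx ((QuotientAddGroup.eq_zero_iff x).1 h)
  obtain ⟨c, hc⟩ := CharacterModule.exists_character_apply_ne_zero_of_ne_zero hx'
  let e : ℚ →+ Additive ℂˣ :=
    { toFun := fun r => Additive.ofMul (Units.mk0 (Complex.exp (r * (2 * Real.pi * Complex.I)))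
        (Complex.exp_ne_zero _))
      map_zero' := congrArg Additive.ofMul (Units.ext (by simp))
      map_add' := fun r s => congrArg Additive.ofMul (Units.ext (by
        simp [add_mul, Complex.exp_add])) }
  have he : ∀ r : ℚ, e r = 0 ↔ r ∈ AddSubgroup.zmultiples (1 : ℚ) := by
    intro r
    have h1 : e r = 0 ↔ Complex.exp (r * (2 * Real.pi * Complex.I)) = 1 :=
      ⟨fun h => congrArg (fun z : Additive ℂˣ => (z.toMul : ℂ)) h,
        fun h => congrArg Additive.ofMul (Units.ext h)⟩
    rw [h1, Complex.exp_eq_one_iff, AddSubgroup.mem_zmultiples_iff]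
    refine exists_congr fun n => ?_
    rw [mul_left_inj' Complex.two_pi_I_ne_zero, zsmul_one, eq_comm]
    exact_mod_cast Iff.rfl
  let E : AddCircle (1 : ℚ) →+ Additive ℂˣ := QuotientAddGroup.lift _ e fun r hr => (he r).2 hr
  refine ⟨(E.comp c).comp (QuotientAddGroup.mk' N), fun y hy => ?_, fun h => hc ?_⟩
  · have : (QuotientAddGroup.mk' N) y = 0 := (QuotientAddGroup.eq_zero_iff y).2 hy
    rw [AddMonoidHom.comp_apply, this, map_zero]
  · change E (c x) = 0 at h
    obtain ⟨r, hr⟩ := QuotientAddGroup.mk_surjective (c (x : M ⧸ N))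
    rw [← hr] at h ⊢
    exact (QuotientAddGroup.eq_zero_iff r).2 ((he r).1 h)

/-! ### Cocycles detecting the cokernel of `q_*` -/

theorem evalChain_single_one_eq {G : Type u} [Group G]
    (F : (G × G →₀ ULift.{u} ℤ) →+ Additive ℂˣ) (x : G × G →₀ ULift.{u} ℤ) :
    evalChain (fun p => (F (Finsupp.single p 1)).toMul) x = F x := by
  have : (evalChain (fun p => (F (Finsupp.single p 1)).toMul)).toAddMonoidHom = F := by
    refine Finsupp.addHom_ext fun p n => ?_
    refine (evalChain_single _ _ _).trans ?_
    rw [ofMul_toMul, ← map_zsmul, Finsupp.smul_single]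
    congr 2
    ext; simp
  exact DFunLike.congr_fun this x

theorem evalChain_comp_map {G G' : Type u} [Group G] [Group G'] {A : Type*} [CommGroup A]
    (q : G' →* G) (f : G × G → A) (x : G' × G' →₀ ULift.{u} ℤ) :
    evalChain (fun p => f (q p.1, q p.2)) x =
      evalChain f (Finsupp.mapDomain (Prod.map q q) x) :=
  (Finsupp.linearCombination_mapDomain (ULift.{u} ℤ) (v' := fun p => Additive.ofMul (f p))
    (Prod.map q q) x).symm

theorem mapH₂_H2π {G G' : Type u} [Group G] [Group G'] (q : G' →* G)
    (x : groupHomology.cycles₂ (trivialInt G')) :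
    ∃ y : groupHomology.cycles₂ (trivialInt G),
      mapH₂ q (groupHomology.H2π (trivialInt G') x) = groupHomology.H2π (trivialInt G) y ∧
      (y : G × G →₀ ULift.{u} ℤ) = Finsupp.mapDomain (Prod.map q q) x.1 := by
  refine ⟨groupHomology.mapCycles₂ (A := trivialInt G') (B := trivialInt G) q (𝟙 _) x, ?_, ?_⟩
  · exact groupHomology.H2π_comp_map_apply (A := trivialInt G') (B := trivialInt G) q (𝟙 _) x
  · refine (groupHomology.coe_mapCycles₂ (A := trivialInt G') (B := trivialInt G) q (𝟙 _) x).trans ?_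
    exact Finsupp.mapRange_id (Finsupp.mapDomain (Prod.map q q) x.1)

theorem evalH₂_mapH₂ {G G' : Type u} [Group G] [Group G'] {A : Type*} [CommGroup A]
    (q : G' →* G) {f : G × G → A} (hf : IsCocycle f)
    (hf' : IsCocycle fun p : G' × G' => f (q p.1, q p.2)) (h : H₂ G') :
    evalH₂ f hf (mapH₂ q h) = evalH₂ (fun p => f (q p.1, q p.2)) hf' h := by
  obtain ⟨x, rfl⟩ := H2π_surjective G' h
  obtain ⟨y, hy, hyx⟩ := mapH₂_H2π q x
  calc evalH₂ f hf (mapH₂ q (groupHomology.H2π (trivialInt G') x))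
      = evalH₂ f hf (groupHomology.H2π (trivialInt G) y) := congrArg _ hy
    _ = evalChain f y.1 := evalH₂_H2π f hf y
    _ = evalChain f (Finsupp.mapDomain (Prod.map q q) x.1) := congrArg _ hyx
    _ = evalChain (fun p => f (q p.1, q p.2)) x.1 := (evalChain_comp_map q f x.1).symm
    _ = _ := (evalH₂_H2π _ hf' x).symm

/-- Every homomorphism from `H_2(G)` to `ℂ^*` is the evaluation of a cocycle. -/
theorem exists_evalH₂_eq {G : Type u} [Group G] (φ : H₂ G →+ Additive ℂˣ) :
    ∃ (f : G × G → ℂˣ) (hf : IsCocycle f), ∀ h, evalH₂ f hf h = φ h := by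
  -- `φ`, read on cycles, is extended to all 2-chains; the values of `F` on basis elements form the
  -- cochain. Its cocycle identity says that `F` kills the boundary of `(a, b, c)`.
  obtain ⟨F, hF⟩ := exists_addMonoidHom_comp_eq
    (groupHomology.cycles₂ (trivialInt G)).subtype.toAddMonoidHom
    (φ.comp (groupHomology.H2π (trivialInt G)).hom.toAddMonoidHom) (by
      intro x hx
      have : x = 0 := Subtype.ext hx
      rw [this, map_zero])
  have hF' : ∀ x : groupHomology.cycles₂ (trivialInt G),
    F x.1 = φ (groupHomology.H2π (trivialInt G) x) := hF
  have hf : IsCocycle fun p : G × G => (F (Finsupp.single p 1)).toMul := by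
    intro a b c
    have h2 : (groupHomology.d₃₂ (trivialInt G)).hom (Finsupp.single (a, b, c) 1) =
        ((Finsupp.single (b, c) 1 - Finsupp.single (a * b, c) 1 + Finsupp.single (a, b * c) 1 -
          Finsupp.single (a, b) 1 : G × G →₀ ULift.{u} ℤ)) :=
      groupHomology.d₃₂_single (A := trivialInt G) (a, b, c) 1
    have hb : (groupHomology.d₃₂ (trivialInt G)).hom (Finsupp.single (a, b, c) 1) ∈
      groupHomology.boundaries₂ (trivialInt G) := ⟨_, rfl⟩
    have h3 := hF' ⟨_, groupHomology.boundaries₂_le_cycles₂ _ hb⟩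
    rw [(groupHomology.H2π_eq_zero_iff (A := trivialInt G) _).2 hb, map_zero] at h3
    have h4 := (congrArg F h2).symm.trans h3
    rw [map_sub, map_add, map_sub, sub_eq_zero, sub_add_eq_add_sub, sub_eq_iff_eq_add,
      add_comm (F (Finsupp.single (a, b) 1))] at h4
    exact h4
  refine ⟨_, hf, fun h => ?_⟩
  obtain ⟨x, rfl⟩ := H2π_surjective G h
  exact (evalH₂_H2π _ hf x).trans ((evalChain_single_one_eq F x.1).trans (hF' x))

/-- A cocycle with trivial evaluation on homology is a coboundary. -/
theorem exists_coboundary {G : Type u} [Group G] {f : G × G → ℂˣ} (hf : IsCocycle f)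
    (h : ∀ x, evalH₂ f hf x = 0) : ∃ g : G → ℂˣ, ∀ a b, f (a, b) * g (a * b) = g a * g b := by
  -- The hypothesis says that evaluation of `f` kills all 2-cycles, so it factors through `d₂₁` as a
  -- homomorphism `L` on 1-chains.
  obtain ⟨L, hL⟩ := exists_addMonoidHom_comp_eq
    (groupHomology.d₂₁ (trivialInt G)).hom.toAddMonoidHom (evalChain f).toAddMonoidHom (by
      intro x hx
      have := h (groupHomology.H2π (trivialInt G) ⟨x, hx⟩)
      rwa [evalH₂_H2π] at this)
  refine ⟨fun a => (L (Finsupp.single a 1)).toMul, fun a b => ?_⟩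
  have h2 : (groupHomology.d₂₁ (trivialInt G)).hom (Finsupp.single (a, b) 1) =
        ((Finsupp.single b 1 - Finsupp.single (a * b) 1 + Finsupp.single a 1 :
          G →₀ ULift.{u} ℤ)) :=
    groupHomology.d₂₁_single (A := trivialInt G) (a, b) 1
  have h3 := (congrArg L h2).symm.trans ((hL (Finsupp.single (a, b) 1)).trans
    (evalChain_single f (a, b) 1))
  rw [map_add, map_sub, ULift.one_down, one_smul, sub_add_eq_add_sub, sub_eq_iff_eq_add,
    add_comm (L (Finsupp.single b 1))] at h3
  exact h3.symm

/-! ### Functoriality of evaluation in the coefficients -/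

theorem evalH₂_map {G : Type u} [Group G] {A B : Type*} [CommGroup A] [CommGroup B] (φ : A →* B)
    {f : G × G → A} (hf : IsCocycle f) (hf' : IsCocycle fun p => φ (f p)) (h : H₂ G) :
    (evalH₂ (fun p => φ (f p)) hf' h).toMul = φ (evalH₂ f hf h).toMul := by
  obtain ⟨x, rfl⟩ := H2π_surjective G h
  have key : (evalChain fun p => φ (f p)).toAddMonoidHom =
      (MonoidHom.toAdditive φ).comp (evalChain f).toAddMonoidHom :=
    Finsupp.addHom_ext fun p n => (evalChain_single _ _ _).trans
      ((map_zsmul (MonoidHom.toAdditive φ) n.down (Additive.ofMul (f p))).symm.trans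
        (congrArg (MonoidHom.toAdditive φ) (evalChain_single f p n).symm))
  have h1 := evalH₂_H2π _ hf' x
  have h2 := evalH₂_H2π _ hf x
  have h3 := DFunLike.congr_fun key x.1
  exact congrArg Additive.toMul
    (h1.trans (h3.trans (congrArg (MonoidHom.toAdditive φ) h2.symm)))

theorem evalH₂_mul {G : Type u} [Group G] {A : Type*} [CommGroup A]
    {f g : G × G → A} (hf : IsCocycle f) (hg : IsCocycle g)
    (hfg : IsCocycle fun p => f p * g p) (h : H₂ G) :
    evalH₂ (fun p => f p * g p) hfg h = evalH₂ f hf h + evalH₂ g hg h := by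
  obtain ⟨x, rfl⟩ := H2π_surjective G h
  have key : (evalChain fun p => f p * g p) = evalChain f + evalChain g := by
    refine Finsupp.lhom_ext fun p n => ?_
    rw [LinearMap.add_apply, evalChain_single, evalChain_single, evalChain_single, ofMul_mul,
      smul_add]
  have h1 := evalH₂_H2π _ hfg x
  have h2 := evalH₂_H2π _ hf x
  have h3 := evalH₂_H2π _ hg x
  exact h1.trans ((LinearMap.congr_fun key x.1).trans (congrArg₂ (· + ·) h2.symm h3.symm))

theorem IsCocycle.map {G : Type u} [Group G] {A B : Type*} [CommGroup A] [CommGroup B]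
    {f : G × G → A} (hf : IsCocycle f) (φ : A →* B) : IsCocycle fun p => φ (f p) := by
  intro a b c
  rw [← map_mul, ← map_mul, hf]

theorem IsCocycle.mul {G : Type u} [Group G] {A : Type*} [CommGroup A]
    {f g : G × G → A} (hf : IsCocycle f) (hg : IsCocycle g) : IsCocycle fun p => f p * g p := by
  intro a b c
  rw [mul_mul_mul_comm, hf, hg, mul_mul_mul_comm]

theorem IsCocycle.comp {G G' : Type u} [Group G] [Group G'] {A : Type*} [CommGroup A]
    {f : G × G → A} (hf : IsCocycle f) (q : G' →* G) : IsCocycle fun p => f (q p.1, q p.2) := by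
  intro a b c
  simp only [map_mul, hf _ _ _]

/-- A coboundary evaluates trivially on homology. -/
theorem evalH₂_eq_zero {G : Type u} [Group G] {A : Type*} [CommGroup A] {f : G × G → A}
    (hf : IsCocycle f) (l : G → A) (h : ∀ a b, f (a, b) * (l a * l b) = l (a * b)) (x : H₂ G) :
    evalH₂ f hf x = 0 :=
  -- The comparison cocycle is the constant `1`, written as the image of `f` under the trivial
  -- homomorphism so that `evalH₂_map` computes its value.
  (evalH₂_congr (hf.map 1) hf l (fun a b => by simpa using h a b) x).trans
    (evalH₂_map (1 : A →* A) hf (hf.map 1) x)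

/-! ### Determinants and Galois conjugates of matrices -/

theorem det_scalarGL (n : ℕ) (z : ℂˣ) :
    Matrix.GeneralLinearGroup.det (scalarGL n z) = z ^ n := by
  ext
  change Matrix.det (algebraMap ℂ (Matrix (Fin n) (Fin n) ℂ) z) = _
  rw [Matrix.algebraMap_eq_diagonal]
  simp

theorem scalarGL_one_det (M : GL (Fin 1) ℂ) :
    scalarGL 1 (Matrix.GeneralLinearGroup.det M) = M := by
  ext i j
  change algebraMap ℂ (Matrix (Fin 1) (Fin 1) ℂ) (Matrix.det M.val) i j = _
  rw [Subsingleton.elim i 0, Subsingleton.elim j 0, Matrix.algebraMap_eq_diagonal]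
  simp

/-- The action of an automorphism of `ℂ` on matrices. -/
abbrev galGL (σ : ℂ ≃+* ℂ) (n : ℕ) : GL (Fin n) ℂ →* GL (Fin n) ℂ :=
  Matrix.GeneralLinearGroup.map (σ : ℂ →+* ℂ)

theorem galGL_scalarGL (σ : ℂ ≃+* ℂ) (n : ℕ) (z : ℂˣ) :
    galGL σ n (scalarGL n z) = scalarGL n (Units.map (σ : ℂ →* ℂ) z) := by
  ext i j
  change σ (algebraMap ℂ (Matrix (Fin n) (Fin n) ℂ) z i j) =
    algebraMap ℂ (Matrix (Fin n) (Fin n) ℂ) (σ z) i j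
  rw [Matrix.algebraMap_matrix_apply, Matrix.algebraMap_matrix_apply]
  split_ifs <;> simp

theorem galGL_symm_galGL (σ : ℂ ≃+* ℂ) (n : ℕ) (M : GL (Fin n) ℂ) :
    galGL σ.symm n (galGL σ n M) = M := by
  ext i j
  exact σ.symm_apply_apply _

/-! ### Twisted representations -/

/-- The representation `h ↦ χ(h) σ(ρ(h))`. -/
def twist {Γ : Type u} [Group Γ] {n : ℕ} (σ : ℂ ≃+* ℂ) (χ : Γ →* ℂˣ) (ρ : Γ →* GL (Fin n) ℂ) :
    Γ →* GL (Fin n) ℂ where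
  toFun h := scalarGL n (χ h) * galGL σ n (ρ h)
  map_one' := by
    rw [map_one, map_one, map_one, mul_one]
    exact map_one (Units.map _)
  map_mul' a b := by
    rw [map_mul, map_mul, map_mul, scalarGL_mul, mul_assoc, mul_assoc,
      ← mul_assoc (scalarGL n (χ b)), scalarGL_comm (χ b), mul_assoc]

theorem twist_apply {Γ : Type u} [Group Γ] {n : ℕ} (σ : ℂ ≃+* ℂ) (χ : Γ →* ℂˣ)
    (ρ : Γ →* GL (Fin n) ℂ) (h : Γ) :
    twist σ χ ρ h = scalarGL n (χ h) * galGL σ n (ρ h) := rfl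

/-- The `σ`-semilinear bijection `v ↦ σ ∘ v` carries `ρ` to its twist up to nonzero scalars, so it
matches the invariant subspaces of the two. -/
theorem twist_mulVec {Γ : Type u} [Group Γ] {n : ℕ} (σ : ℂ ≃+* ℂ) (χ : Γ →* ℂˣ)
    (ρ : Γ →* GL (Fin n) ℂ) (h : Γ) (v : Fin n → ℂ) :
    toRepresentation (twist σ χ ρ) h (σ ∘ v) =
      (χ h : ℂ) • (σ ∘ toRepresentation ρ h v) := by
  rw [toRepresentation_apply, toRepresentation_apply, twist_apply, coe_scalarGL_mul,
    Matrix.smul_mulVec]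
  congr 1
  ext i
  simp [Matrix.mulVec, dotProduct]

theorem twist_isIrreducible {Γ : Type u} [Group Γ] {n : ℕ} (σ : ℂ ≃+* ℂ) (χ : Γ →* ℂˣ)
    (ρ : IrrRep Γ n) : (toRepresentation (twist σ χ ρ.1)).IsIrreducible := by
  have hn := nonempty_of_irr ρ
  have hirr := ρ.2
  refine { exists_pair_ne := ⟨⊥, ⊤, fun h => ?_⟩, eq_bot_or_eq_top := fun W => ?_ }
  · have h1 : (⊥ : Submodule ℂ (Fin n → ℂ)) = ⊤ := congrArg Subrepresentation.toSubmodule h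
    exact bot_ne_top h1
  · let V : Subrepresentation (toRepresentation ρ.1) :=
      { toSubmodule :=
          { carrier := {v | σ ∘ v ∈ W.toSubmodule}
            add_mem' := fun {a b} ha hb => by
              have e : σ ∘ (a + b) = σ ∘ a + σ ∘ b := by ext; simp
              simpa only [Set.mem_ofPred_eq, e] using add_mem ha hb
            zero_mem' := by
              have e : σ ∘ (0 : Fin n → ℂ) = 0 := by ext; simp
              simp only [Set.mem_ofPred_eq, e, zero_mem]
            smul_mem' := fun c v hv => by
              have e : σ ∘ (c • v) = σ c • (σ ∘ v) := by ext; simp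
              simpa only [Set.mem_ofPred_eq, e] using W.toSubmodule.smul_mem _ hv }
        apply_mem_toSubmodule := fun g v hv => by
          have h1 := W.apply_mem_toSubmodule g hv
          rw [twist_mulVec] at h1
          exact (W.toSubmodule.smul_mem_iff (χ g).ne_zero).1 h1 }
    have hV : ∀ w, w ∈ W.toSubmodule ↔ σ.symm ∘ w ∈ V.toSubmodule := fun w => by
      have e : σ ∘ (σ.symm ∘ w) = w := by ext; simp
      change _ ↔ σ ∘ (σ.symm ∘ w) ∈ W.toSubmodule
      rw [e]
    refine (eq_bot_or_eq_top V).imp (fun h => ?_) fun h => ?_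
    · refine Subrepresentation.toSubmodule_injective (eq_bot_iff.2 fun w hw => ?_)
      rw [hV, h] at hw
      have hw' : σ.symm ∘ w = 0 := hw
      refine (Submodule.mem_bot ℂ).2 (funext fun i => ?_)
      exact σ.symm.injective ((congrFun hw' i).trans (map_zero _).symm)
    · refine Subrepresentation.toSubmodule_injective (eq_top_iff.2 fun w _ => ?_)
      rw [hV, h]
      exact Submodule.mem_top (R := ℂ) (x := σ.symm ∘ w)

/-- The irreducible representation `h ↦ χ(h) σ(ρ(h))`. -/
def twistIrrRep {Γ : Type u} [Group Γ] {n : ℕ} (σ : ℂ ≃+* ℂ) (χ : Γ →* ℂˣ) (ρ : IrrRep Γ n) :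
    IrrRep Γ n :=
  ⟨twist σ χ ρ.1, twist_isIrreducible σ χ ρ⟩

theorem twistIrrRep_apply {Γ : Type u} [Group Γ] {n : ℕ} (σ : ℂ ≃+* ℂ) (χ : Γ →* ℂˣ)
    (ρ : IrrRep Γ n) (h : Γ) :
    (twistIrrRep σ χ ρ).1 h = scalarGL n (χ h) * galGL σ n (ρ.1 h) := rfl

/-- The scalar `χ(h)` cancels from a conjugacy relation, and the conjugating matrix is transported
by `σ` or `σ⁻¹`. -/
theorem twistIrrRep_equiv_iff {Γ : Type u} [Group Γ] {n : ℕ} (σ : ℂ ≃+* ℂ) (χ : Γ →* ℂˣ)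
    (ρ ρ' : IrrRep Γ n) : twistIrrRep σ χ ρ ≈ twistIrrRep σ χ ρ' ↔ ρ ≈ ρ' := by
  constructor
  · rintro ⟨M, hM⟩
    refine ⟨galGL σ.symm n M, fun h => ?_⟩
    have h1 := hM h
    rw [twistIrrRep_apply, twistIrrRep_apply] at h1
    rw [← mul_assoc, ← scalarGL_comm, mul_assoc, mul_assoc, mul_right_inj, ← mul_assoc] at h1
    have h2 := congrArg (galGL σ.symm n) h1
    rwa [map_mul, map_mul, galGL_symm_galGL, galGL_symm_galGL, map_inv] at h2
  · rintro ⟨M, hM⟩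
    refine ⟨galGL σ n M, fun h => ?_⟩
    rw [twistIrrRep_apply, twistIrrRep_apply, hM, map_mul, map_mul, map_inv, ← mul_assoc _ (scalarGL n _), ← scalarGL_comm]
    simp only [mul_assoc]

/-- The twist of an equivalence class of irreducible representations. -/
def twistIrr {Γ : Type u} [Group Γ] {n : ℕ} (σ : ℂ ≃+* ℂ) (χ : Γ →* ℂˣ) : Irr Γ n → Irr Γ n :=
  Quotient.lift (fun ρ : IrrRep Γ n => (Quotient.mk _ (twistIrrRep σ χ ρ) : Irr Γ n))
    fun ρ ρ' h => Quotient.sound ((twistIrrRep_equiv_iff σ χ ρ ρ').2 h)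

theorem twistIrr_mk {Γ : Type u} [Group Γ] {n : ℕ} (σ : ℂ ≃+* ℂ) (χ : Γ →* ℂˣ)
    (ρ : IrrRep Γ n) :
    twistIrr σ χ (Quotient.mk _ ρ : Irr Γ n) = (Quotient.mk _ (twistIrrRep σ χ ρ) : Irr Γ n) := rfl

theorem twistIrr_injective {Γ : Type u} [Group Γ] {n : ℕ} (σ : ℂ ≃+* ℂ) (χ : Γ →* ℂˣ) :
    Function.Injective (twistIrr (n := n) σ χ) := fun c c' =>
  Quotient.inductionOn₂ c c' fun ρ ρ' h =>
    Quotient.sound ((twistIrrRep_equiv_iff σ χ ρ ρ').1 (Quotient.exact h))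

/-! ### Invariant characters and the effect of twisting on the cocycle -/

section Kernel

variable {G G' : Type u} [Group G] [Group G'] (q : G' →* G) {n : ℕ}

/-- A character of `Γ = Ker q` invariant under conjugation by `G'`. -/
def IsInvariant (χ : q.ker →* ℂˣ) : Prop := ∀ x h, χ (conjInv q x h) = χ h

theorem isInvariant_one : IsInvariant q 1 := fun _ _ => rfl

variable {q}

theorem Intertwines.twist {χ : q.ker →* ℂˣ} (hχ : IsInvariant q χ) (σ : ℂ ≃+* ℂ)
    {ρ : q.ker →* GL (Fin n) ℂ} {x : G'} {M : GL (Fin n) ℂ} (hM : Intertwines q ρ x M) :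
    Intertwines q (twist σ χ ρ) x (galGL σ n M) := by
  intro h
  rw [twist_apply, twist_apply, hχ, hM, map_mul, map_mul, map_inv, ← mul_assoc _ (scalarGL n _),
    ← scalarGL_comm]
  simp only [mul_assoc]

/-- The choices for a twisted representation obtained from those for the representation. -/
def Choices.twist {χ : q.ker →* ℂˣ} (hχ : IsInvariant q χ) (σ : ℂ ≃+* ℂ) {ρ : IrrRep q.ker n}
    (D : Choices q ρ) : Choices q (twistIrrRep σ χ ρ) where
  lift := D.lift
  map_lift := D.map_lift
  M α := galGL σ n (D.M α)
  intertwines α := (D.intertwines α).twist hχ σ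

/-- Apply `σ` to the relation defining `ζ`; the factor `χ` enters only through `ρ` of the defect. -/
theorem Choices.zeta_twist {χ : q.ker →* ℂˣ} (hχ : IsInvariant q χ) (σ : ℂ ≃+* ℂ)
    {ρ : IrrRep q.ker n} (D : Choices q ρ) (a b : G) :
    (D.twist hχ σ).zeta (a, b) = Units.map (σ : ℂ →* ℂ) (D.zeta (a, b)) * χ (D.defect a b) := by
  have h1 := (D.twist hχ σ).zeta_spec' a b
  have h2 := congrArg (galGL σ n) (D.zeta_spec' a b)
  rw [map_mul, map_mul, galGL_scalarGL, map_mul] at h2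
  change _ * (galGL σ n (D.M a) * galGL σ n (D.M b)) =
    galGL σ n (D.M (a * b)) * (scalarGL n (χ (D.defect a b)) * galGL σ n (ρ.1 (D.defect a b))) at h1
  rw [← mul_assoc (galGL σ n (D.M (a * b))), ← scalarGL_comm, mul_assoc, ← h2,
    ← mul_assoc (scalarGL n (χ _)), ← scalarGL_mul] at h1
  rw [scalarGL_injective q ρ (mul_right_cancel h1), mul_comm]

theorem Choices.eval_gal (σ : ℂ ≃+* ℂ) {ρ : IrrRep q.ker n} (D : Choices q ρ) (h : H₂ G) :
    (D.twist (isInvariant_one q) σ).eval h = Units.map (σ : ℂ →* ℂ) (D.eval h) := by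
  refine Eq.trans ?_ (evalH₂_map (Units.map (σ : ℂ →* ℂ)) D.zeta_isCocycle
    (D.zeta_isCocycle.map _) h)
  refine congrArg Additive.toMul (evalH₂_congr _ _ 1 (fun a b => ?_) h)
  rw [Choices.zeta_twist]
  simp

/-- Evaluating `g` on `lift a * lift b = lift (a * b) * defect a b` in two ways shows that `χ ∘
defect` is `f⁻¹` up to the coboundary of `g ∘ lift`. -/
theorem Choices.eval_twist {χ : q.ker →* ℂˣ} (hχ : IsInvariant q χ) {f : G × G → ℂˣ}
    (hf : IsCocycle f) {g : G' → ℂˣ} (hg : ∀ a b, f (q a, q b) * g (a * b) = g a * g b)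
    (hgχ : ∀ x (γ : q.ker), g (x * γ) = g x * χ γ) {ρ : IrrRep q.ker n} (D : Choices q ρ)
    (h : H₂ G) :
    (D.twist hχ (RingEquiv.refl ℂ)).eval h = D.eval h * (evalH₂ f hf h).toMul⁻¹ := by
  have hfi : IsCocycle fun p => (f p)⁻¹ := hf.map invMonoidHom
  have e1 := evalH₂_map (invMonoidHom : ℂˣ →* ℂˣ) hf hfi h
  have e2 := evalH₂_mul D.zeta_isCocycle hfi (D.zeta_isCocycle.mul hfi) h
  have e3 := evalH₂_congr (D.zeta_isCocycle.mul hfi) (D.twist hχ (RingEquiv.refl ℂ)).zeta_isCocycle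
    (fun a => (g (D.lift a))⁻¹) (fun a b => ?_) h
  · rw [e2] at e3
    refine (congrArg Additive.toMul e3).trans ?_
    exact congrArg (D.eval h * ·) e1
  · have h1 := hg (D.lift a) (D.lift b)
    have h2 := hgχ (D.lift (a * b)) (D.defect a b)
    have e : D.lift (a * b) * (D.defect a b : G') = D.lift a * D.lift b := by
      simp [Choices.defect, mul_assoc]
    rw [e] at h2
    rw [D.map_lift, D.map_lift, h2] at h1
    rw [Choices.zeta_twist]
    have e0 : Units.map ((RingEquiv.refl ℂ : ℂ ≃+* ℂ) : ℂ →* ℂ) (D.zeta (a, b)) = D.zeta (a, b) := by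
      ext; rfl
    rw [e0, ← mul_inv, ← h1]
    simp only [mul_inv]
    have e' : ∀ z c f g : ℂˣ, z * c * (f⁻¹ * (g⁻¹ * c⁻¹)) = z * f⁻¹ * g⁻¹ := fun z c f g => by
      rw [← mul_assoc f⁻¹, mul_comm _ c⁻¹, mul_assoc z, mul_inv_cancel_left, mul_assoc]
    exact e' _ _ _ _

/-- The values `ζ_ρ(h)` are roots of unity. -/
theorem Choices.eval_pow [Finite q.ker] {ρ : IrrRep q.ker n} (D : Choices q ρ) (h : H₂ G) :
    D.eval h ^ (n * Nat.card q.ker) = 1 := by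
  refine (evalH₂_map (powMonoidHom (n * Nat.card q.ker)) D.zeta_isCocycle
    (D.zeta_isCocycle.map _) h).symm.trans ?_
  -- Taking determinants turns `ζ` into `ζ ^ n`; the further power `|Γ|` kills the determinant of
  -- `ρ` on the defect. What remains is a coboundary.
  refine congrArg Additive.toMul (evalH₂_eq_zero _
    (fun a => Matrix.GeneralLinearGroup.det (D.M a) ^ Nat.card q.ker) (fun a b => ?_) h)
  have h1 := congrArg Matrix.GeneralLinearGroup.det (D.zeta_spec' a b)
  rw [map_mul, map_mul, map_mul, det_scalarGL] at h1
  have h2 := congrArg (· ^ Nat.card q.ker) h1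
  simp only [mul_pow, ← pow_mul, ← map_pow ρ.1, ← map_pow Matrix.GeneralLinearGroup.det,
    pow_card_eq_one', map_one, mul_one] at h2
  simpa only [powMonoidHom_apply, map_pow] using h2

/-- For `n = 1` the determinant of `proj_mul` exhibits the pull-back of `ζ` to `G'` as the
coboundary of `det ∘ proj`. -/
theorem Choices.eval_mapH₂ {ρ : IrrRep q.ker 1} (D : Choices q ρ) (h : H₂ G') :
    D.eval (mapH₂ q h) = 1 := by
  refine congrArg Additive.toMul ((evalH₂_mapH₂ q D.zeta_isCocycle (D.zeta_isCocycle.comp q) h).trans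
    (evalH₂_eq_zero _ (fun x => Matrix.GeneralLinearGroup.det (D.proj x)) (fun a b => ?_) h))
  have h1 := congrArg Matrix.GeneralLinearGroup.det (D.proj_mul a b)
  rwa [map_mul, map_mul, det_scalarGL, pow_one] at h1

theorem Choices.eval_zero {ρ : IrrRep q.ker n} (D : Choices q ρ) : D.eval 0 = 1 :=
  congrArg Additive.toMul (map_zero (evalH₂ D.zeta D.zeta_isCocycle))

/-- An element of `H_2(G)` outside the image of `H_2(G')` is detected by a cocycle whose
pull-back to `G'` is the coboundary of a function extending an invariant character of `Ker q`. -/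
theorem exists_character_of_notMem_range {h : H₂ G} (hh : h ∉ LinearMap.range (mapH₂ q)) :
    ∃ (χ : q.ker →* ℂˣ) (f : G × G → ℂˣ) (hf : IsCocycle f) (g : G' → ℂˣ), IsInvariant q χ ∧
      (∀ a b, f (q a, q b) * g (a * b) = g a * g b) ∧
      (∀ x (γ : q.ker), g (x * γ) = g x * χ γ) ∧ evalH₂ f hf h ≠ 0 := by
  obtain ⟨φ, hφ, hφh⟩ := exists_addMonoidHom_ne_zero (LinearMap.range (mapH₂ q)).toAddSubgroup hh
  obtain ⟨f, hf, hfφ⟩ := exists_evalH₂_eq φ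
  obtain ⟨g, hg⟩ := exists_coboundary (hf.comp q) fun x => by
    rw [← evalH₂_mapH₂ q hf, hfφ]
    exact hφ _ ⟨x, rfl⟩
  simp only at hg
  -- The cocycle `f` need not be normalized; the constant `f (1, 1)` must be divided out for `g` to
  -- become multiplicative on `Γ`.
  have hl : ∀ a, f (1, a) = f (1, 1) := fun a => by
    have := hf 1 1 a
    rw [one_mul, one_mul] at this
    exact mul_left_cancel this
  have hr : ∀ a, f (a, 1) = f (1, 1) := fun a => by
    have := hf a 1 1
    rw [one_mul, mul_one] at this
    exact (mul_right_cancel this).symm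
  have hqk : ∀ γ : q.ker, q γ = 1 := fun γ => γ.2
  have hgl : ∀ (γ : q.ker) x, g (γ * x) = (f (1, 1))⁻¹ * g γ * g x := fun γ x => by
    rw [mul_assoc, eq_inv_mul_iff_mul_eq, ← hg, hqk, hl (q x)]
  have hgr : ∀ x (γ : q.ker), g (x * γ) = g x * ((f (1, 1))⁻¹ * g γ) := fun x γ => by
    rw [mul_left_comm, eq_inv_mul_iff_mul_eq, ← hg, hqk, hr (q x)]
  let χ : q.ker →* ℂˣ := MonoidHom.mk' (fun γ => (f (1, 1))⁻¹ * g γ) fun a b => by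
    rw [Subgroup.coe_mul, hgl, mul_assoc, mul_assoc,
      mul_left_comm (g a)]
  refine ⟨χ, f, hf, g, fun x γ => ?_, hg, hgr, (hfφ h).trans_ne hφh⟩
  -- Expanding `g` on both sides of `x (x⁻¹γx) = γx` gives invariance of `χ`.
  have e : x * (conjInv q x γ : G') = γ * x := by rw [coe_conjInv]; group
  have h1 := hgr x (conjInv q x γ)
  rw [e, hgl, mul_comm] at h1
  exact (mul_left_cancel h1).symm

end Kernel

/-! ### Permutations of the invariant classes and the sums `v k` -/

section Kernel

variable {G G' : Type u} [Group G] [Group G'] {q : G' →* G} {n : ℕ}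

theorem Choices.stabilizer_eq_top {ρ : IrrRep q.ker n} (D : Choices q ρ) :
    stabilizer q ρ.1 = ⊤ :=
  eq_top_iff.2 fun α _ => ⟨D.lift α, D.map_lift α, D.M α, D.intertwines α⟩

theorem exists_choices (c : InvIrr q n) :
    ∃ (ρ : IrrRep q.ker n) (_ : Choices q ρ), c.1 = Quotient.mk _ ρ := by
  obtain ⟨c, hc⟩ := c
  induction c using Quotient.inductionOn with
  | h ρ => exact ⟨ρ, (nonempty_choices q ρ hc).some, rfl⟩

theorem zetaValue_eq_eval (c : InvIrr q n) {ρ : IrrRep q.ker n} (D : Choices q ρ)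
    (hρ : c.1 = Quotient.mk _ ρ) (h : H₂ G) : zetaValue q c.1 c.2 h = D.eval h := by
  obtain ⟨c, hc⟩ := c
  subst hρ
  exact zetaValue_mk q ρ D hc h

/-- Twisting acts on the equivalence classes of invariant irreducible representations. -/
def twistClass {χ : q.ker →* ℂˣ} (hχ : IsInvariant q χ) (σ : ℂ ≃+* ℂ) (c : InvIrr q n) :
    InvIrr q n :=
  ⟨twistIrr σ χ c.1, by
    obtain ⟨ρ, D, hρ⟩ := exists_choices c
    rw [hρ, twistIrr_mk]
    exact (D.twist hχ σ).stabilizer_eq_top⟩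

theorem twistClass_bijective [Finite q.ker] {χ : q.ker →* ℂˣ} (hχ : IsInvariant q χ)
    (σ : ℂ ≃+* ℂ) : Function.Bijective (twistClass (n := n) hχ σ) :=
  Finite.injective_iff_bijective.1 fun _ _ h =>
    Subtype.ext (twistIrr_injective σ χ (congrArg Subtype.val h))

theorem zetaValue_twistClass {χ : q.ker →* ℂˣ} (hχ : IsInvariant q χ) (σ : ℂ ≃+* ℂ)
    (c : InvIrr q n) {ρ : IrrRep q.ker n} (D : Choices q ρ) (hρ : c.1 = Quotient.mk _ ρ)
    (h : H₂ G) :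
    zetaValue q (twistClass hχ σ c).1 (twistClass hχ σ c).2 h = (D.twist hχ σ).eval h :=
  zetaValue_eq_eval (twistClass hχ σ c) (D.twist hχ σ) (congrArg (twistIrr σ χ) hρ) h

theorem v_eq_sum [Finite q.ker] (h : H₂ G) [Fintype (InvIrr q n)] :
    v q n h = ∑ c : InvIrr q n, (zetaValue q c.1 c.2 h : ℂ) :=
  finsum_eq_sum_of_fintype _

theorem v_eq_invCount [Finite q.ker] {h : H₂ G}
    (hv : ∀ {ρ : IrrRep q.ker n} (D : Choices q ρ), D.eval h = 1) : v q n h = invCount q n := by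
  have := Fintype.ofFinite (InvIrr q n)
  have h1 : ∀ c : InvIrr q n, (zetaValue q c.1 c.2 h : ℂ) = 1 := fun c => by
    obtain ⟨ρ, D, hρ⟩ := exists_choices c
    rw [zetaValue_eq_eval c D hρ, hv, Units.val_one]
  rw [v_eq_sum, Finset.sum_congr rfl fun c _ => h1 c, invCount, Nat.card_eq_fintype_card]
  simp

theorem map_v [Finite q.ker] (σ : ℂ ≃+* ℂ) (h : H₂ G) : σ (v q n h) = v q n h := by
  have := Fintype.ofFinite (InvIrr q n)
  rw [v_eq_sum, map_sum]
  refine Fintype.sum_bijective _ (twistClass_bijective (isInvariant_one q) σ) _ _ fun c => ?_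
  obtain ⟨ρ, D, hρ⟩ := exists_choices c
  rw [zetaValue_twistClass _ σ c D hρ, zetaValue_eq_eval c D hρ, Choices.eval_gal]
  rfl

theorem v_eq_zero [Finite q.ker] {h : H₂ G} (hh : h ∉ LinearMap.range (mapH₂ q)) :
    v q n h = 0 := by
  have := Fintype.ofFinite (InvIrr q n)
  obtain ⟨χ, f, hf, g, hχ, hg, hgχ, hfh⟩ := exists_character_of_notMem_range hh
  have h1 : v q n h * ((evalH₂ f hf h).toMul⁻¹ : ℂˣ) = v q n h := by
    rw [v_eq_sum, Finset.sum_mul]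
    refine Fintype.sum_bijective _ (twistClass_bijective hχ (RingEquiv.refl ℂ)) _ _ fun c => ?_
    obtain ⟨ρ, D, hρ⟩ := exists_choices c
    rw [zetaValue_twistClass _ _ c D hρ, zetaValue_eq_eval c D hρ,
      Choices.eval_twist hχ hf hg hgχ, Units.val_mul]
  by_contra h0
  refine hfh ?_
  have h2 : (evalH₂ f hf h).toMul⁻¹ = 1 := Units.ext ((mul_eq_left₀ h0).1 h1)
  exact congrArg Additive.ofMul (inv_eq_one.1 h2)

theorem zetaValue_pow [Finite q.ker] (c : InvIrr q n) (h : H₂ G) :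
    (zetaValue q c.1 c.2 h : ℂ) ^ (n * Nat.card q.ker) = 1 := by
  obtain ⟨ρ, D, hρ⟩ := exists_choices c
  rw [zetaValue_eq_eval c D hρ, ← Units.val_pow_eq_pow_val, D.eval_pow, Units.val_one]

/-- A sum of `N_n` roots of unity is an algebraic integer of absolute value at most `N_n`. The
assumption `1 ≤ n` makes the exponent `n * |Γ|` nonzero. -/
theorem exists_int_v_eq [Finite q.ker] (hn : 1 ≤ n) (h : H₂ G) :
    ∃ m : ℤ, v q n h = m ∧ -(invCount q n : ℤ) ≤ m ∧ m ≤ invCount q n := by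
  have := Fintype.ofFinite (InvIrr q n)
  have hpos : n * Nat.card q.ker ≠ 0 := mul_ne_zero (by omega) Nat.card_pos.ne'
  have hint : IsIntegral ℤ (v q n h) := by
    rw [v_eq_sum]
    refine IsIntegral.sum _ fun c _ => IsIntegral.of_pow (Nat.pos_of_ne_zero hpos) ?_
    rw [zetaValue_pow]
    exact isIntegral_one
  obtain ⟨m, hm⟩ := exists_int_of_forall_ringEquiv hint fun σ => map_v σ h
  have hle : ‖v q n h‖ ≤ invCount q n := by
    rw [v_eq_sum, invCount, Nat.card_eq_fintype_card]
    refine (norm_sum_le _ _).trans ?_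
    rw [Finset.sum_congr rfl fun c _ => Complex.norm_eq_one_of_pow_eq_one (zetaValue_pow c h) hpos]
    simp
  rw [hm, Complex.norm_intCast, ← Int.cast_abs] at hle
  have hle' : |m| ≤ (invCount q n : ℤ) := by exact_mod_cast hle
  exact ⟨m, hm, abs_le.1 hle'⟩

/-! ### One-dimensional representations -/

theorem isIrreducible_of_one {Γ : Type u} [Group Γ] (ρ : Γ →* GL (Fin 1) ℂ) :
    (toRepresentation ρ).IsIrreducible := by
  have : IsSimpleOrder (Submodule ℂ (Fin 1 → ℂ)) := 
    is_simple_module_of_finrank_eq_one (Module.finrank_fin_fun ℂ)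
  refine { exists_pair_ne := ⟨⊥, ⊤, fun h => ?_⟩, eq_bot_or_eq_top := fun W => ?_ }
  · have h1 : (⊥ : Submodule ℂ (Fin 1 → ℂ)) = ⊤ := congrArg Subrepresentation.toSubmodule h
    exact bot_ne_top h1
  · exact (eq_bot_or_eq_top W.toSubmodule).imp
      (fun h => Subrepresentation.toSubmodule_injective h)
      fun h => Subrepresentation.toSubmodule_injective h

/-- The one-dimensional representation given by a character. -/
def charRep {Γ : Type u} [Group Γ] (χ : Γ →* ℂˣ) : IrrRep Γ 1 :=
  ⟨(Units.map (algebraMap ℂ (Matrix (Fin 1) (Fin 1) ℂ)).toMonoidHom).comp χ,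
    isIrreducible_of_one _⟩

theorem det_charRep {Γ : Type u} [Group Γ] (χ : Γ →* ℂˣ) (h : Γ) :
    Matrix.GeneralLinearGroup.det ((charRep χ).1 h) = χ h :=
  (det_scalarGL 1 (χ h)).trans (pow_one _)

theorem charRep_det {Γ : Type u} [Group Γ] (ρ : IrrRep Γ 1) :
    charRep (Matrix.GeneralLinearGroup.det.comp ρ.1) = ρ :=
  Subtype.ext (MonoidHom.ext fun h => scalarGL_one_det (ρ.1 h))

/-- Conjugation of `1 × 1` matrices is trivial, so a class is the same as its determinant character,
and `G_ρ = G` means invariance of that character. -/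
theorem card_isInvariant (hq : Function.Surjective q) :
    Nat.card {χ : q.ker →* ℂˣ // IsInvariant q χ} = invCount q 1 := by
  have hstab : ∀ χ : q.ker →* ℂˣ, IsInvariant q χ → stabilizer q (charRep χ).1 = ⊤ := by
    intro χ hχ
    refine eq_top_iff.2 fun α _ => ?_
    obtain ⟨x, hx⟩ := hq α
    refine ⟨x, hx, 1, fun h => ?_⟩
    rw [inv_one, one_mul, mul_one]
    exact congrArg (scalarGL 1) (hχ x h)
  refine Nat.card_congr (Equiv.ofBijective
    (fun χ => (⟨Quotient.mk _ (charRep χ.1), hstab χ.1 χ.2⟩ : InvIrr q 1)) ⟨fun χ χ' h => ?_,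
      fun c => ?_⟩)
  · obtain ⟨M, hM⟩ := Quotient.exact (congrArg Subtype.val h)
    refine Subtype.ext (MonoidHom.ext fun x => ?_)
    have h1 := congrArg Matrix.GeneralLinearGroup.det (hM x)
    rw [map_mul, map_mul, det_charRep, det_charRep, map_inv, mul_right_comm, inv_mul_cancel,
      one_mul] at h1
    exact h1.symm
  · obtain ⟨ρ, D, hρ⟩ := exists_choices c
    refine ⟨⟨Matrix.GeneralLinearGroup.det.comp ρ.1, fun x h => ?_⟩, Subtype.ext ?_⟩
    · have h1 := congrArg Matrix.GeneralLinearGroup.det (D.proj_intertwines x h)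
      rwa [map_mul, map_mul, map_inv, mul_right_comm, inv_mul_cancel, one_mul] at h1
    · exact (congrArg (Quotient.mk _) (charRep_det ρ)).trans hρ.symm

theorem isInvariant_iff (χ : q.ker →* ℂˣ) :
    IsInvariant q χ ↔ (⁅q.ker, (⊤ : Subgroup G')⁆).subgroupOf q.ker ≤ χ.ker := by
  constructor
  · intro hχ γ hγ
    have hle : ⁅q.ker, (⊤ : Subgroup G')⁆ ≤ χ.ker.map q.ker.subtype := by
      refine Subgroup.commutator_le.2 fun γ hγ x _ => ?_
      -- This is `γ · xγ⁻¹x⁻¹`, the commutator of `γ` and `x`.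
      refine ⟨⟨γ, hγ⟩ * conjInv q x⁻¹ ⟨γ, hγ⟩⁻¹, ?_, ?_⟩
      · rw [SetLike.mem_coe, MonoidHom.mem_ker, map_mul, hχ, map_inv, mul_inv_cancel]
      · rw [Subgroup.subtype_apply, Subgroup.coe_mul, coe_conjInv]
        simp [commutatorElement_def, mul_assoc]
    obtain ⟨δ, hδ, e⟩ := hle (Subgroup.mem_subgroupOf.1 hγ)
    rwa [← Subtype.ext e]
  · intro hχ x h
    have h1 : h⁻¹ * conjInv q x h ∈ (⁅q.ker, (⊤ : Subgroup G')⁆).subgroupOf q.ker := by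
      have h2 := Subgroup.commutator_mem_commutator (inv_mem h.2) (Subgroup.mem_top x⁻¹)
      rw [Subgroup.mem_subgroupOf, Subgroup.coe_mul, coe_conjInv]
      simpa [commutatorElement_def, mul_assoc] using h2
    have h3 := hχ h1
    rw [MonoidHom.mem_ker, map_mul, map_inv, inv_mul_eq_one] at h3
    exact h3.symm

/-- Invariant characters are those of the quotient `Γ/[Γ, G']`, which is abelian since `[Γ, Γ] ≤ [Γ,
G']`; a finite abelian group has as many complex characters as elements. -/
theorem invCount_one [Finite q.ker] (hq : Function.Surjective q) :
    invCount q 1 = Nat.card (q.ker ⧸ (⁅q.ker, (⊤ : Subgroup G')⁆).subgroupOf q.ker) := by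
  let N := (⁅q.ker, (⊤ : Subgroup G')⁆).subgroupOf q.ker
  have hN : N.Normal := inferInstance
  let : CommGroup (q.ker ⧸ N) :=
    { (inferInstance : Group (q.ker ⧸ N)) with
      mul_comm := fun a b => by
        obtain ⟨a, rfl⟩ := QuotientGroup.mk_surjective a
        obtain ⟨b, rfl⟩ := QuotientGroup.mk_surjective b
        refine QuotientGroup.eq.2 ?_
        have h2 := Subgroup.commutator_mem_commutator (inv_mem b.2) (Subgroup.mem_top (a : G')⁻¹)
        rw [Subgroup.mem_subgroupOf]
        simpa [commutatorElement_def, mul_assoc] using h2 }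
  rw [← card_isInvariant hq,
    ← CommGroup.card_monoidHom_of_hasEnoughRootsOfUnity (q.ker ⧸ N) ℂ]
  exact Nat.card_congr
    { toFun := fun χ => QuotientGroup.lift N χ.1 ((isInvariant_iff χ.1).1 χ.2)
      invFun := fun ψ => ⟨ψ.comp (QuotientGroup.mk' N), (isInvariant_iff _).2 fun x hx => by
        have : QuotientGroup.mk' N x = 1 := (QuotientGroup.eq_one_iff x).2 hx
        rw [MonoidHom.mem_ker, MonoidHom.comp_apply, this, map_one]⟩
      left_inv := fun χ => Subtype.ext (MonoidHom.ext fun x => rfl)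
      right_inv := fun ψ => QuotientGroup.monoidHom_ext _ (MonoidHom.ext fun x => rfl) }

end Kernel

end

end GroupExt

theorem lemmal5 {G G' : Type u} [Group G] [Group G'] (q : G' →* G)
    (hq : Function.Surjective q) [Finite q.ker] :
    (∀ k : ℕ, 1 ≤ k →
      (∀ h : GroupExt.H₂ G, ∃ m : ℤ, GroupExt.v q k h = (m : ℂ) ∧
        -(GroupExt.invCount q k : ℤ) ≤ m ∧ m ≤ (GroupExt.invCount q k : ℤ)) ∧
      (∀ h : GroupExt.H₂ G, h ∉ LinearMap.range (GroupExt.mapH₂ q) → GroupExt.v q k h = 0)) ∧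
    ((∀ h ∈ LinearMap.range (GroupExt.mapH₂ q),
        GroupExt.v q 1 h = (GroupExt.invCount q 1 : ℂ)) ∧
      GroupExt.invCount q 1 = Nat.card (q.ker ⧸ (⁅q.ker, (⊤ : Subgroup G')⁆).subgroupOf q.ker)) ∧
    (∀ k : ℕ, 1 ≤ k → GroupExt.v q k 0 = (GroupExt.invCount q k : ℂ)) := by
  refine ⟨fun k hk => ⟨fun h => GroupExt.exists_int_v_eq hk h, fun h hh => GroupExt.v_eq_zero hh⟩,
    ⟨?_, GroupExt.invCount_one hq⟩, fun k _ => GroupExt.v_eq_invCount fun D => D.eval_zero⟩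
  rintro _ ⟨h, rfl⟩
  exact GroupExt.v_eq_invCount fun D => D.eval_mapH₂ h
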